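/- Let $1\le k\le n$ be integers, let $\Omega=\Omega_1\times\cdots\times\Omega_n$ be a product of finite sets, let $\mu$ be a probability distribution on $\Omega$ (not necessarily of full support), and let $C>0$ be real. Let $P_{\mu,k}$ be the transition kernel of $k$-Glauber dynamics: from $x$, choose a set $S\subseteq\{1,\dots,n\}$ of size $k$ uniformly at random and resample the coordinates in $S$ from $\mu(X_S=\cdot\mid X_{S^c}=x_{S^c})$. Write $P_\mu=P_{\mu,1}$. We use the following notions. A kernel $P$ with stationary distribution $\mu$ satisfies a Poincaré inequality with constant $K$ if $\operatorname{Var}_\mu(f)\le K\langle f,(I-P)f\rangle_\mu$ for all $f:\Omega\to\mathbb R$; "$\mu$ satisfies a Poincaré inequality" means that $P_\mu$ does. A kernel $P$ satisfies $\rho$-contraction in a divergence $D$ with respect to $\mu$ if $D(\nu P\,\|\,\mu P)\le\rho\,D(\nu\,\|\,\mu)$ for all probability distributions $\nu\ll\mu$; here $D$ is $\chi^2(\nu\|\mu)=\mathbb E_\mu(\frac{\nu}{\mu}-1)^2$ or $\mathrm{KL}(\nu\|\mu)=\mathbb E_\mu\frac{\nu}{\mu}\ln\frac{\nu}{\mu}$.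 The homogenization $\mu^{\hom}$ is the image of $\mu$ under $\sigma\mapsto\{(1,\sigma_1),\dots,(n,\sigma_n)\}$, a distribution on the $n$-element subsets of $\bigsqcup_i\Omega_i$. The measure $\mu$ satisfies $C$-approximate tensorization of entropy if the kernel that removes a uniformly random element from an $n$-element subset of $\bigsqcup_i\Omega_i$ satisfies $\bigl(1-\frac1{Cn}\bigr)$-contraction in KL-divergence with respect to $\mu^{\hom}$. Finally, $\lambda_2(P)$ is the second largest eigenvalue, with multiplicity, of $P$ on $L^2(\mu)$. There are absolute constants $c,K>0$, independent of $n,k,C,\Omega,\mu$, such that $\bigl(1-\frac{k}{n+1}\bigr)^{\frac1{C+1}}\le 1-c\,\frac{k}{(C+1)n}$ and the following hold. 1. If $\mu$ satisfies a Poincaré inequality with constant $Cn$, then $$\lambda_2(P_{\mu,k})\le\Bigl(1-\frac{k}{n+1}\Bigr)^{\frac1{C+1}}$$ (if the support of $\mu$ has at least two points, so that $\lambda_2$ exists), $P_{\mu,k}$ satisfies a Poincaré inequality with constant $K\,\frac{Cn}{k}$, and $P_{\mu,k}$ satisfies $\bigl(1-c\,\frac{k}{Cn}\bigr)$-contraction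 in $\chi^2$-divergence with respect to $\mu$. 2. If $\mu$ satisfies $C$-approximate tensorization of entropy, then $P_{\mu,k}$ satisfies $\rho$-contraction in KL-divergence with respect to $\mu$, both for $\rho=\bigl(1-\frac{k}{n+1}\bigr)^{\frac1{C+1}}$ and for $\rho=1-c\,\frac{k}{Cn}$. -/

import Mathlib

open scoped Matrix

noncomputable section

namespace KGlauber

universe u v

/-! Measures on finite sets are identified with their mass functions; a probability distribution
on `A` is an element of `stdSimplex ℝ A`; a kernel from `A` to `B` is a matrix `Matrix A B ℝ`, and
the image of a measure `ν` under `P` is the row vector `ν ᵥ* P`. -/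

section Functional

variable {A : Type u} {B : Type v} [Fintype A] [Fintype B]

/-- Variance of `f` under `μ`. -/
def variance (μ : A → ℝ) (f : A → ℝ) : ℝ :=
  ∑ x, μ x * (f x - ∑ y, μ y * f y) ^ 2

/-- The Dirichlet form `⟨f, (I - P) g⟩_μ`. -/
def dirichletForm (μ : A → ℝ) (P : Matrix A A ℝ) (f g : A → ℝ) : ℝ :=
  ∑ x, μ x * (f x * (g x - (P *ᵥ g) x))

/-- `P`, with stationary distribution `μ`, satisfies a Poincaré inequality with constant `K`. -/
def Poincare (μ : A → ℝ) (P : Matrix A A ℝ) (K : ℝ) : Prop :=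
  ∀ f : A → ℝ, variance μ f ≤ K * dirichletForm μ P f f

/-- The `φ`-divergence `D_φ(ν ‖ μ) = 𝔼_{x ∼ μ} φ(ν(x)/μ(x))`, used for `ν ≪ μ`. -/
def divergence (φ : ℝ → ℝ) (ν μ : A → ℝ) : ℝ :=
  ∑ x, μ x * φ (ν x / μ x)

/-- The function that generates the `χ²`-divergence. -/
def chiSqFun (t : ℝ) : ℝ := (t - 1) ^ 2

/-- The function that generates the KL-divergence. -/
def klFun (t : ℝ) : ℝ := t * Real.log t

/-- `P` satisfies `ρ`-contraction in `φ`-divergence with respect to `μ`: for every probability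
distribution `ν ≪ μ`, `D_φ(νP ‖ μP) ≤ ρ D_φ(ν ‖ μ)`. -/
def Contracts (φ : ℝ → ℝ) (μ : A → ℝ) (P : Matrix A B ℝ) (ρ : ℝ) : Prop :=
  ∀ ν ∈ stdSimplex ℝ A, (∀ x, μ x = 0 → ν x = 0) →
    divergence φ (ν ᵥ* P) (μ ᵥ* P) ≤ ρ * divergence φ ν μ

/-- The real eigenvalues of a square matrix, with algebraic multiplicity, in decreasing order. -/
def eigenvaluesDesc [DecidableEq A] (M : Matrix A A ℝ) : List ℝ :=
  M.charpoly.roots.sort (· ≥ ·)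

/-- The transition matrix of a chain restricted to the support of `μ`. -/
def onSupport (μ : A → ℝ) (P : Matrix A A ℝ) : Matrix {x // 0 < μ x} {x // 0 < μ x} ℝ :=
  P.submatrix Subtype.val Subtype.val

/-- `λ₂(P)`: the second largest eigenvalue of the chain `P` with stationary distribution `μ`, acting
on `L²(μ)`, that is, on functions on the support of `μ`. It is used for chains that are reversible
with respect to `μ` (so that all eigenvalues are real) and whose support has at least two points;
the default value is then never taken. -/
def lambda2 [DecidableEq A] (μ : A → ℝ) (P : Matrix A A ℝ) : ℝ :=
  (eigenvaluesDesc (onSupport μ P)).getD 1 0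

end Functional

section Homogeneous

/-- The `k`-element subsets of `α`. -/
abbrev Slice (α : Type u) (k : ℕ) : Type u := {A : Finset α // A.card = k}

variable {α : Type u} [Fintype α] [DecidableEq α]

/-- The down operator from `k`-subsets to `l`-subsets. -/
def down (α : Type u) [DecidableEq α] (k l : ℕ) : Matrix (Slice α k) (Slice α l) ℝ :=
  Matrix.of fun A B => if B.1 ⊆ A.1 then 1 / (k.choose l : ℝ) else 0

/-- `C`-approximate tensorization of entropy for a measure on the `k`-subsets of `α`. -/
def ApproxTensorizationHom {k : ℕ} (μ : Slice α k → ℝ) (C : ℝ) : Prop :=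
  Contracts klFun μ (down α k (k - 1)) (1 - 1 / (C * k))

end Homogeneous

section Product

variable {n : ℕ} {Ω : Fin n → Type u} [∀ i, Fintype (Ω i)] [∀ i, DecidableEq (Ω i)]

/-- The configuration `σ` as the set `{(1, σ₁), …, (n, σₙ)}` in the disjoint union of the `Ω i`. -/
def graphSet (σ : ∀ i, Ω i) : Finset (Σ i, Ω i) :=
  Finset.univ.image fun i => ⟨i, σ i⟩

/-- The homogenization of `μ`: the image of `μ` under `graphSet`. -/
def homogenization (μ : (∀ i, Ω i) → ℝ) : Slice (Σ i, Ω i) n → ℝ :=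
  fun A => ∑ σ, if graphSet σ = A.1 then μ σ else 0

/-- `C`-approximate tensorization of entropy for a measure on a product space. -/
def ApproxTensorization (μ : (∀ i, Ω i) → ℝ) (C : ℝ) : Prop :=
  ApproxTensorizationHom (homogenization μ) C

/-- `μ(X_{Sᶜ} = x_{Sᶜ})`. -/
def marginalOff (μ : (∀ i, Ω i) → ℝ) (S : Finset (Fin n)) (x : ∀ i, Ω i) : ℝ :=
  ∑ z : ∀ i, Ω i, if ∀ i, i ∉ S → z i = x i then μ z else 0

/-- Resample the coordinates in `S` from `μ(X_S = · | X_{Sᶜ} = x_{Sᶜ})`. If the conditioning event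
is null (which is impossible for `x` in the support of `μ`), the chain stays at `x`. -/
def resample (μ : (∀ i, Ω i) → ℝ) (S : Finset (Fin n)) :
    Matrix (∀ i, Ω i) (∀ i, Ω i) ℝ :=
  Matrix.of fun x y =>
    if marginalOff μ S x = 0 then (if y = x then 1 else 0)
    else if ∀ i, i ∉ S → y i = x i then μ y / marginalOff μ S x else 0

/-- The transition kernel `P_{μ,k}` of `k`-Glauber dynamics. -/
def glauber (μ : (∀ i, Ω i) → ℝ) (k : ℕ) : Matrix (∀ i, Ω i) (∀ i, Ω i) ℝ :=
  Matrix.of fun x y =>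
    (∑ S ∈ Finset.powersetCard k (Finset.univ : Finset (Fin n)), resample μ S x y) /
      (n.choose k : ℝ)

end Product

/-- The rate `(1 - k/(n+1))^{1/(C+1)}`. -/
def rate (n k : ℕ) (C : ℝ) : ℝ :=
  (1 - (k : ℝ) / ((n : ℝ) + 1)) ^ (1 / (C + 1))

end KGlauber

end

/-! Write `R_S` for `resample μ S`, the conditional expectation given the coordinates off `S`; on
the support of `μ`, `R_S R_T = R_T R_S = R_T` whenever `S ⊆ T`. Both hypotheses give one inequality
(`Tensorizes`) for a convex `φ`, either `(t - 1)²` or `t log t`: the average over `i` of the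
`φ`-mean of `R_{i} f` is at most `1 - 1/(Cn)` times that of `f`.

Applied to `R_S f`, the indices in `S` change nothing, and for `i ∉ S` Jensen bounds the `φ`-mean of
`R_{S ∪ i} f` by that of `R_{i} R_S f`. Averaging over `k`-sets gives `L_{k+1} ≤ (1 - 1/(C(n-k)))
L_k` for `L_k = levelMean φ μ k f` (`Tensorizes.levelMean_succ_le`). Since `1 - 1/(Cl) ≤
(l/(l+1))^{1/(C+1)}`, the product telescopes to `rate` (`Tensorizes.levelMean_le_rate`).

As `P_{μ,k}` is the average of the `R_S`, Jensen bounds the `φ`-mean of `P_{μ,k} f` by `L_k`, which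
is contraction. For `χ²`, `⟨f, R_S f⟩ = ‖R_S f‖²` makes the Dirichlet form equal to the variance
minus `L_k`; this yields the Poincaré inequality and, by min-max, the bound on `λ₂`. In the bounds
with `C` in place of `C + 1`, `rate` suffices for `C ≥ 1`, while `C < 1` forces a one-point support
(`Tensorizes.eq_of_lt_one`). -/

noncomputable section

namespace KGlauber

universe u v

/-! ### Reversible kernels and Jensen's inequality. -/

section Kernel

variable {A : Type u} [Fintype A]

/-- The `φ`-entropy of `f` under `μ`. -/
def phiMean (φ : ℝ → ℝ) (μ f : A → ℝ) : ℝ := ∑ x, μ x * φ (f x)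

/-- A Markov kernel that is reversible with respect to `μ`. -/
structure IsReversible (μ : A → ℝ) (P : Matrix A A ℝ) : Prop where
  nonneg : ∀ x y, 0 ≤ P x y
  row_sum : ∀ x, ∑ y, P x y = 1
  balance : ∀ x y, μ x * P x y = μ y * P y x

variable {μ : A → ℝ} {P : Matrix A A ℝ}

/-- By reversibility, densities with respect to `μ` evolve under `P` itself, so divergence
contraction becomes a statement about `P *ᵥ f`. -/
theorem IsReversible.vecMul_eq (h : IsReversible μ P) (f : A → ℝ) (y : A) :
    ((fun x => μ x * f x) ᵥ* P) y = μ y * (P *ᵥ f) y := by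
  simp only [Matrix.vecMul, Matrix.mulVec, dotProduct, Finset.mul_sum]
  refine Finset.sum_congr rfl fun x _ => ?_
  linear_combination f x * h.balance x y

theorem IsReversible.mulVec_one (h : IsReversible μ P) (a : ℝ) (x : A) :
    (P *ᵥ fun _ => a) x = a := by
  simp [Matrix.mulVec, dotProduct, ← Finset.sum_mul, h.row_sum]

theorem IsReversible.stationary (h : IsReversible μ P) : μ ᵥ* P = μ := by
  funext y
  have := h.vecMul_eq (fun _ => 1) y
  rw [h.mulVec_one] at this
  simpa using this

theorem IsReversible.selfAdjoint (h : IsReversible μ P) (f g : A → ℝ) :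
    ∑ x, μ x * (f x * (P *ᵥ g) x) = ∑ x, μ x * ((P *ᵥ f) x * g x) := by
  simp only [Matrix.mulVec, dotProduct, Finset.mul_sum, Finset.sum_mul]
  rw [Finset.sum_comm]
  refine Finset.sum_congr rfl fun x _ => Finset.sum_congr rfl fun y _ => ?_
  linear_combination f y * g x * h.balance y x

theorem IsReversible.sum_mulVec (h : IsReversible μ P) (f : A → ℝ) :
    ∑ x, μ x * (P *ᵥ f) x = ∑ x, μ x * f x := by
  have := h.selfAdjoint (fun _ => 1) f
  simpa [h.mulVec_one] using this

theorem IsReversible.mulVec_mem (h : IsReversible μ P) {s : Set ℝ} (hs : Convex ℝ s) {f : A → ℝ}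
    (hf : ∀ x, f x ∈ s) (x : A) : (P *ᵥ f) x ∈ s := by
  have := hs.sum_mem (t := Finset.univ) (w := P x) (z := f) (fun y _ => h.nonneg x y)
    (h.row_sum x) (fun y _ => hf y)
  simpa [Matrix.mulVec, dotProduct] using this

theorem IsReversible.phiMean_mulVec_le (h : IsReversible μ P) (hμ : ∀ x, 0 ≤ μ x) {s : Set ℝ}
    {φ : ℝ → ℝ} (hφ : ConvexOn ℝ s φ) {f : A → ℝ} (hf : ∀ x, f x ∈ s) :
    phiMean φ μ (P *ᵥ f) ≤ phiMean φ μ f := by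
  have key : ∀ x, φ ((P *ᵥ f) x) ≤ (P *ᵥ fun y => φ (f y)) x := fun x => by
    have := hφ.map_sum_le (t := Finset.univ) (w := P x) (p := f) (fun y _ => h.nonneg x y)
      (h.row_sum x) (fun y _ => hf y)
    simpa [Matrix.mulVec, dotProduct] using this
  calc phiMean φ μ (P *ᵥ f) ≤ ∑ x, μ x * (P *ᵥ fun y => φ (f y)) x :=
        Finset.sum_le_sum fun x _ => mul_le_mul_of_nonneg_left (key x) (hμ x)
    _ = phiMean φ μ f := h.sum_mulVec _

theorem phiMean_congr {φ : ℝ → ℝ} {f g : A → ℝ} (h : ∀ x, μ x ≠ 0 → f x = g x) :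
    phiMean φ μ f = phiMean φ μ g := by
  refine Finset.sum_congr rfl fun x _ => ?_
  by_cases hx : μ x = 0
  · simp [hx]
  · rw [h x hx]

/-- The line `a (t - 1)` has mean zero along a density, so it can be subtracted from `φ` for free.
-/
theorem phiMean_nonneg {s : Set ℝ} {φ : ℝ → ℝ} {a : ℝ} (hμ : μ ∈ stdSimplex ℝ A)
    (hφ : ∀ t ∈ s, a * (t - 1) ≤ φ t) {f : A → ℝ} (hf : ∀ x, f x ∈ s)
    (hm : ∑ x, μ x * f x = 1) : 0 ≤ phiMean φ μ f := by
  have h0 : ∑ x, μ x * (a * (f x - 1)) = 0 := by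
    have : ∀ x, μ x * (a * (f x - 1)) = a * (μ x * f x) - a * μ x := fun x => by ring
    simp only [this, Finset.sum_sub_distrib, ← Finset.mul_sum, hm, hμ.2, sub_self]
  rw [← h0]
  exact Finset.sum_le_sum fun x _ => mul_le_mul_of_nonneg_left (hφ _ (hf x)) (hμ.1 x)

theorem eq_one_of_phiMean_nonpos {s : Set ℝ} {φ : ℝ → ℝ} {a : ℝ} (hμ : μ ∈ stdSimplex ℝ A)
    (hφ : ∀ t ∈ s, t ≠ 1 → a * (t - 1) < φ t) (hφ1 : φ 1 = 0) {f : A → ℝ} (hf : ∀ x, f x ∈ s)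
    (hm : ∑ x, μ x * f x = 1) (h : phiMean φ μ f ≤ 0) {x : A} (hx : μ x ≠ 0) : f x = 1 := by
  have hle : ∀ t ∈ s, 0 ≤ φ t - a * (t - 1) := fun t ht => by
    by_cases h1 : t = 1
    · simp [h1, hφ1]
    · exact sub_nonneg.2 (hφ t ht h1).le
  have h0 : ∑ x, μ x * (φ (f x) - a * (f x - 1)) ≤ 0 := by
    have : ∀ x, μ x * (φ (f x) - a * (f x - 1)) = μ x * φ (f x) - a * (μ x * f x) + a * μ x :=
      fun x => by ring
    simp only [this, Finset.sum_sub_distrib, Finset.sum_add_distrib, ← Finset.mul_sum, hm, hμ.2]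
    simpa [phiMean] using h
  have hn : ∀ x ∈ Finset.univ, 0 ≤ μ x * (φ (f x) - a * (f x - 1)) :=
    fun x _ => mul_nonneg (hμ.1 x) (hle _ (hf x))
  have := (Finset.sum_eq_zero_iff_of_nonneg hn).1 (le_antisymm h0 (Finset.sum_nonneg hn)) x
    (Finset.mem_univ x)
  by_contra h1
  rcases mul_eq_zero.1 this with h2 | h2
  · exact hx h2
  · linarith [hφ _ (hf x) h1]

end Kernel

/-! ### Block resampling as conditional expectation. -/

section Resample

variable {n : ℕ} {Ω : Fin n → Type u} [∀ i, Fintype (Ω i)] [∀ i, DecidableEq (Ω i)]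
  {μ : (∀ i, Ω i) → ℝ}

theorem marginalOff_congr {S : Finset (Fin n)} {x y : ∀ i, Ω i} (h : ∀ i, i ∉ S → x i = y i) :
    marginalOff μ S x = marginalOff μ S y := by
  refine Finset.sum_congr rfl fun z _ => ?_
  have : (∀ i, i ∉ S → z i = x i) ↔ (∀ i, i ∉ S → z i = y i) :=
    forall₂_congr fun i hi => by rw [h i hi]
  simp only [this]

theorem le_marginalOff (hμ : ∀ x, 0 ≤ μ x) (S : Finset (Fin n)) (x : ∀ i, Ω i) :
    μ x ≤ marginalOff μ S x := by
  have := Finset.single_le_sum (f := fun z : ∀ i, Ω i =>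
    if ∀ i, i ∉ S → z i = x i then μ z else 0) (s := Finset.univ)
    (fun z _ => by split_ifs <;> simp [hμ z]) (Finset.mem_univ x)
  simpa [marginalOff] using this

theorem marginalOff_ne_zero (hμ : ∀ x, 0 ≤ μ x) (S : Finset (Fin n)) {x : ∀ i, Ω i}
    (hx : μ x ≠ 0) : marginalOff μ S x ≠ 0 :=
  (((hμ x).lt_of_ne' hx).trans_le (le_marginalOff hμ S x)).ne'

theorem resample_apply (hμ : ∀ x, 0 ≤ μ x) (S : Finset (Fin n)) {x : ∀ i, Ω i} (hx : μ x ≠ 0)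
    (y : ∀ i, Ω i) :
    resample μ S x y = if ∀ i, i ∉ S → y i = x i then μ y / marginalOff μ S x else 0 := by
  simp [resample, marginalOff_ne_zero hμ S hx]

theorem resample_mulVec (hμ : ∀ x, 0 ≤ μ x) (S : Finset (Fin n)) {x : ∀ i, Ω i} (hx : μ x ≠ 0)
    (f : (∀ i, Ω i) → ℝ) :
    (resample μ S *ᵥ f) x =
      (∑ z, if ∀ i, i ∉ S → z i = x i then μ z * f z else 0) / marginalOff μ S x := by
  simp only [Matrix.mulVec, dotProduct, resample_apply hμ S hx, Finset.sum_div]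
  refine Finset.sum_congr rfl fun z _ => ?_
  split_ifs <;> simp [div_mul_eq_mul_div]

theorem resample_isReversible (hμ : ∀ x, 0 ≤ μ x) (S : Finset (Fin n)) :
    IsReversible μ (resample μ S) where
  nonneg x y := by
    have : 0 ≤ marginalOff μ S x := (hμ x).trans (le_marginalOff hμ S x)
    simp only [resample, Matrix.of_apply]
    split_ifs <;> first | positivity | exact div_nonneg (hμ y) this
  row_sum x := by
    by_cases hx : marginalOff μ S x = 0
    · simp [resample, hx]
    · simp only [resample, Matrix.of_apply, hx, if_false]
      rw [← div_self hx]
      conv_rhs => rw [marginalOff, Finset.sum_div]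
      refine Finset.sum_congr rfl fun z _ => ?_
      split_ifs <;> simp [marginalOff]
  balance x y := by
    have aux : ∀ x y : ∀ i, Ω i, μ x = 0 → μ x * resample μ S x y = μ y * resample μ S y x := by
      intro x y hx
      by_cases hy : μ y = 0
      · simp [hx, hy]
      · simp [resample_apply hμ S hy, hx]
    by_cases hx : μ x = 0
    · exact aux x y hx
    by_cases hy : μ y = 0
    · exact (aux y x hy).symm
    rw [resample_apply hμ S hx, resample_apply hμ S hy]
    by_cases h : ∀ i, i ∉ S → y i = x i
    · rw [if_pos h, if_pos fun i hi => (h i hi).symm, marginalOff_congr h]; ring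
    · rw [if_neg h, if_neg fun h' => h fun i hi => (h' i hi).symm]; simp

/-- The inner function depends only on coordinates off `T`, so it is constant on the fibres that
`resample μ S` averages over. -/
theorem resample_mulVec_resample_of_subset (hμ : ∀ x, 0 ≤ μ x) {S T : Finset (Fin n)}
    (hST : S ⊆ T) (f : (∀ i, Ω i) → ℝ) {x : ∀ i, Ω i} (hx : μ x ≠ 0) :
    (resample μ S *ᵥ (resample μ T *ᵥ f)) x = (resample μ T *ᵥ f) x := by
  rw [resample_mulVec hμ S hx, div_eq_iff (marginalOff_ne_zero hμ S hx), marginalOff,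
    Finset.mul_sum]
  refine Finset.sum_congr rfl fun z _ => ?_
  split_ifs with h
  · by_cases hz : μ z = 0
    · simp [hz]
    rw [mul_comm]
    congr 1
    have h' : ∀ i, i ∉ T → z i = x i := fun i hi => h i fun hiS => hi (hST hiS)
    rw [resample_mulVec hμ T hx, resample_mulVec hμ T hz, marginalOff_congr h']
    congr 1
    refine Finset.sum_congr rfl fun w _ => ?_
    have : (∀ i, i ∉ T → w i = z i) ↔ (∀ i, i ∉ T → w i = x i) :=
      forall₂_congr fun i hi => by rw [h' i hi]
    simp only [this]
  · simp

theorem resample_mulVec_resample_of_superset (hμ : ∀ x, 0 ≤ μ x) {S T : Finset (Fin n)}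
    (hST : S ⊆ T) (f : (∀ i, Ω i) → ℝ) {x : ∀ i, Ω i} (hx : μ x ≠ 0) :
    (resample μ T *ᵥ (resample μ S *ᵥ f)) x = (resample μ T *ᵥ f) x := by
  have hS := resample_isReversible hμ S
  have hT := resample_isReversible hμ T
  -- Self-adjointness moves the kernels onto a test function in reversed order, where the previous
  -- lemma applies; the indicator of `x` then recovers the value at `x`.
  have key : ∀ h : (∀ i, Ω i) → ℝ,
      ∑ y, μ y * (h y * (resample μ T *ᵥ (resample μ S *ᵥ f)) y) =
        ∑ y, μ y * (h y * (resample μ T *ᵥ f) y) := by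
    intro h
    rw [hT.selfAdjoint, hS.selfAdjoint, hT.selfAdjoint]
    refine Finset.sum_congr rfl fun y _ => ?_
    by_cases hy : μ y = 0
    · simp [hy]
    · rw [resample_mulVec_resample_of_subset hμ hST h hy]
  simpa [Pi.single_apply, hx] using key (Pi.single x 1)

theorem resample_empty_mulVec (hμ : ∀ x, 0 ≤ μ x) (f : (∀ i, Ω i) → ℝ) {x : ∀ i, Ω i}
    (hx : μ x ≠ 0) : (resample μ ∅ *ᵥ f) x = f x := by
  have h : ∀ z : ∀ i, Ω i, (∀ i, i ∉ (∅ : Finset (Fin n)) → z i = x i) ↔ z = x := fun z => by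
    simp [funext_iff]
  rw [resample_mulVec hμ ∅ hx, marginalOff]
  simp only [h]
  simp [hx]

theorem resample_univ_mulVec (hμ : μ ∈ stdSimplex ℝ (∀ i, Ω i)) (f : (∀ i, Ω i) → ℝ)
    {x : ∀ i, Ω i} (hx : μ x ≠ 0) :
    (resample μ Finset.univ *ᵥ f) x = ∑ z, μ z * f z := by
  rw [resample_mulVec hμ.1 _ hx, marginalOff]
  simp [hμ.2]

/-- `resample μ S` is an orthogonal projection of `L²(μ)`. -/
theorem sum_mul_mul_resample_mulVec (hμ : ∀ x, 0 ≤ μ x) (S : Finset (Fin n))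
    (f : (∀ i, Ω i) → ℝ) :
    ∑ x, μ x * (f x * (resample μ S *ᵥ f) x) = ∑ x, μ x * (resample μ S *ᵥ f) x ^ 2 := by
  have h : ∑ x, μ x * (f x * (resample μ S *ᵥ f) x) =
      ∑ x, μ x * (f x * (resample μ S *ᵥ (resample μ S *ᵥ f)) x) := by
    refine Finset.sum_congr rfl fun x _ => ?_
    by_cases hx : μ x = 0
    · simp [hx]
    · rw [resample_mulVec_resample_of_subset hμ subset_rfl f hx]
  rw [h, (resample_isReversible hμ S).selfAdjoint]
  exact Finset.sum_congr rfl fun x _ => by ring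

theorem glauber_mulVec (μ : (∀ i, Ω i) → ℝ) (k : ℕ) (f : (∀ i, Ω i) → ℝ) (x : ∀ i, Ω i) :
    (glauber μ k *ᵥ f) x = (∑ S ∈ Finset.powersetCard k (Finset.univ : Finset (Fin n)),
      (resample μ S *ᵥ f) x) / (n.choose k : ℝ) := by
  simp only [Matrix.mulVec, dotProduct, glauber, Matrix.of_apply, Finset.sum_div, Finset.sum_mul]
  rw [Finset.sum_comm]
  exact Finset.sum_congr rfl fun S _ => Finset.sum_congr rfl fun y _ => by ring

theorem glauber_isReversible (hμ : ∀ x, 0 ≤ μ x) {k : ℕ} (hk : k ≤ n) :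
    IsReversible μ (glauber μ k) where
  nonneg x y := div_nonneg
    (Finset.sum_nonneg fun S _ => (resample_isReversible hμ S).nonneg x y) (Nat.cast_nonneg _)
  row_sum x := by
    have hc : (n.choose k : ℝ) ≠ 0 := by exact_mod_cast (Nat.choose_pos hk).ne'
    simp only [glauber, Matrix.of_apply]
    rw [← Finset.sum_div, Finset.sum_comm]
    simp [(resample_isReversible hμ _).row_sum, hc]
  balance x y := by
    simp only [glauber, Matrix.of_apply, ← mul_div_assoc, Finset.mul_sum,
      (resample_isReversible hμ _).balance x y]

/-! ### Level means and their one-step recursion. -/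

/-- The average, over the `k`-sets `S`, of the `φ`-mean of `f` given the coordinates off `S`. -/
def levelMean (φ : ℝ → ℝ) (μ : (∀ i, Ω i) → ℝ) (k : ℕ) (f : (∀ i, Ω i) → ℝ) : ℝ :=
  (∑ S ∈ Finset.powersetCard k (Finset.univ : Finset (Fin n)), phiMean φ μ (resample μ S *ᵥ f)) /
    (n.choose k : ℝ)

theorem levelMean_zero (hμ : ∀ x, 0 ≤ μ x) (φ : ℝ → ℝ) (f : (∀ i, Ω i) → ℝ) :
    levelMean φ μ 0 f = phiMean φ μ f := by
  simp [levelMean, phiMean_congr fun x hx => resample_empty_mulVec hμ f hx]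

theorem phiMean_glauber_mulVec_le (hμ : ∀ x, 0 ≤ μ x) {k : ℕ} (hk : k ≤ n) {s : Set ℝ}
    {φ : ℝ → ℝ} (hφ : ConvexOn ℝ s φ) {f : (∀ i, Ω i) → ℝ} (hf : ∀ x, f x ∈ s) :
    phiMean φ μ (glauber μ k *ᵥ f) ≤ levelMean φ μ k f := by
  have hc : (0 : ℝ) < n.choose k := by exact_mod_cast Nat.choose_pos hk
  simp only [phiMean, levelMean]
  rw [Finset.sum_comm, Finset.sum_div]
  refine Finset.sum_le_sum fun x _ => ?_
  rw [← Finset.mul_sum, mul_div_assoc]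
  refine mul_le_mul_of_nonneg_left ?_ (hμ x)
  have := hφ.map_sum_le (t := Finset.powersetCard k (Finset.univ : Finset (Fin n)))
    (w := fun _ => (n.choose k : ℝ)⁻¹) (p := fun S => (resample μ S *ᵥ f) x)
    (fun _ _ => by positivity) (by simp [hc.ne'])
    (fun S _ => (resample_isReversible hμ S).mulVec_mem hφ.1 hf x)
  rw [glauber_mulVec]
  simp only [smul_eq_mul, ← Finset.mul_sum] at this
  simpa only [div_eq_inv_mul] using this

/-- Tensorization of the `φ`-entropy for densities with values in `s`. -/
def Tensorizes (φ : ℝ → ℝ) (s : Set ℝ) (μ : (∀ i, Ω i) → ℝ) (C : ℝ) : Prop :=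
  ∀ f : (∀ i, Ω i) → ℝ, (∀ x, f x ∈ s) → ∑ x, μ x * f x = 1 →
    ∑ i, phiMean φ μ (resample μ {i} *ᵥ f) ≤ (n - 1 / C) * phiMean φ μ f

/-- Tensorization passes to the marginals of `μ`. -/
theorem Tensorizes.sum_insert_le {φ : ℝ → ℝ} {s : Set ℝ} {C : ℝ} (h : Tensorizes φ s μ C)
    (hμ : ∀ x, 0 ≤ μ x) (hφ : ConvexOn ℝ s φ) {f : (∀ i, Ω i) → ℝ} (hf : ∀ x, f x ∈ s)
    (hm : ∑ x, μ x * f x = 1) (S : Finset (Fin n)) :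
    ∑ i ∈ Sᶜ, phiMean φ μ (resample μ (insert i S) *ᵥ f) ≤
      ((Sᶜ.card : ℝ) - 1 / C) * phiMean φ μ (resample μ S *ᵥ f) := by
  have hS := resample_isReversible hμ S
  have h1 := h (resample μ S *ᵥ f) (hS.mulVec_mem hφ.1 hf) (by rw [hS.sum_mulVec, hm])
  rw [← Finset.sum_add_sum_compl S] at h1
  -- These terms, moved to the right-hand side, lower the coefficient from `n - 1/C` to `|Sᶜ| -
  -- 1/C`.
  have h2 : ∑ i ∈ S, phiMean φ μ (resample μ {i} *ᵥ (resample μ S *ᵥ f)) =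
      S.card * phiMean φ μ (resample μ S *ᵥ f) := by
    rw [← nsmul_eq_mul, ← Finset.sum_const]
    exact Finset.sum_congr rfl fun i hi => phiMean_congr fun x hx =>
      resample_mulVec_resample_of_subset hμ (by simpa using hi) f hx
  have h3 : ∑ i ∈ Sᶜ, phiMean φ μ (resample μ (insert i S) *ᵥ f) ≤
      ∑ i ∈ Sᶜ, phiMean φ μ (resample μ {i} *ᵥ (resample μ S *ᵥ f)) := by
    refine Finset.sum_le_sum fun i _ => ?_
    -- The larger block absorbs both inner resamplings; Jensen then discards the outer kernel.
    have e : phiMean φ μ (resample μ (insert i S) *ᵥ f) = phiMean φ μ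
        (resample μ (insert i S) *ᵥ (resample μ {i} *ᵥ (resample μ S *ᵥ f))) := by
      refine phiMean_congr fun x hx => ?_
      rw [resample_mulVec_resample_of_superset hμ (by simp) _ hx,
        resample_mulVec_resample_of_superset hμ (by simp) _ hx]
    rw [e]
    exact (resample_isReversible hμ _).phiMean_mulVec_le hμ hφ
      ((resample_isReversible hμ _).mulVec_mem hφ.1 (hS.mulVec_mem hφ.1 hf))
  have hcard : (S.card : ℝ) + Sᶜ.card = n := by
    have := Finset.card_add_card_compl S
    rw [Fintype.card_fin] at this
    exact_mod_cast this
  rw [h2, ← hcard] at h1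
  linarith

/-- Double counting: each `T` arises once for each of its `k + 1` elements. -/
theorem sum_powersetCard_sum_insert (k : ℕ) (F : Finset (Fin n) → ℝ) :
    ∑ S ∈ Finset.powersetCard k (Finset.univ : Finset (Fin n)), ∑ i ∈ Sᶜ, F (insert i S) =
      (k + 1) * ∑ T ∈ Finset.powersetCard (k + 1) (Finset.univ : Finset (Fin n)), F T := by
  have h : ∀ T ∈ Finset.powersetCard (k + 1) (Finset.univ : Finset (Fin n)),
      ((k : ℝ) + 1) * F T = ∑ i ∈ T, F T := fun T hT => by
    simp [(Finset.mem_powersetCard.1 hT).2]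
  rw [Finset.mul_sum, Finset.sum_congr rfl h, Finset.sum_sigma', Finset.sum_sigma']
  refine Finset.sum_bij' (fun p _ => ⟨insert p.2 p.1, p.2⟩) (fun q _ => ⟨q.1.erase q.2, q.2⟩)
    ?_ ?_ ?_ ?_ ?_
  · rintro ⟨S, i⟩ h
    simp only [Finset.mem_sigma, Finset.mem_powersetCard, Finset.mem_compl] at h
    simp [Finset.card_insert_of_notMem h.2, h.1.2]
  · rintro ⟨T, i⟩ h
    simp only [Finset.mem_sigma, Finset.mem_powersetCard] at h
    simp [Finset.card_erase_of_mem h.2, h.1.2]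
  · rintro ⟨S, i⟩ h
    simp only [Finset.mem_sigma, Finset.mem_powersetCard, Finset.mem_compl] at h
    simp [Finset.erase_insert h.2]
  · rintro ⟨T, i⟩ h
    simp only [Finset.mem_sigma, Finset.mem_powersetCard] at h
    simp [Finset.insert_erase h.2]
  · rintro ⟨S, i⟩ h
    rfl

theorem Tensorizes.levelMean_succ_le {φ : ℝ → ℝ} {s : Set ℝ} {C : ℝ} (h : Tensorizes φ s μ C)
    (hμ : ∀ x, 0 ≤ μ x) (hφ : ConvexOn ℝ s φ) {f : (∀ i, Ω i) → ℝ} (hf : ∀ x, f x ∈ s)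
    (hm : ∑ x, μ x * f x = 1) {k : ℕ} (hk : k < n) :
    levelMean φ μ (k + 1) f ≤ (1 - 1 / (C * (n - k : ℝ))) * levelMean φ μ k f := by
  have hc : (0 : ℝ) < n.choose k := by exact_mod_cast Nat.choose_pos hk.le
  have hc' : (0 : ℝ) < n.choose (k + 1) := by exact_mod_cast Nat.choose_pos hk
  have hnk : (0 : ℝ) < (n : ℝ) - k := sub_pos.2 (by exact_mod_cast hk)
  have hch : (n.choose (k + 1) : ℝ) * (k + 1) = n.choose k * ((n : ℝ) - k) := by
    have := Nat.choose_succ_right_eq n k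
    rw [← Nat.cast_sub hk.le]
    exact_mod_cast this
  have h1 := Finset.sum_le_sum fun S (hS : S ∈ Finset.powersetCard k
    (Finset.univ : Finset (Fin n))) => h.sum_insert_le hμ hφ hf hm S
  rw [sum_powersetCard_sum_insert k fun S => phiMean φ μ (resample μ S *ᵥ f)] at h1
  have h2 : ∀ S ∈ Finset.powersetCard k (Finset.univ : Finset (Fin n)),
      ((Sᶜ.card : ℝ) - 1 / C) * phiMean φ μ (resample μ S *ᵥ f) =
        ((n : ℝ) - k - 1 / C) * phiMean φ μ (resample μ S *ᵥ f) := fun S hS => by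
    rw [Finset.card_compl, Fintype.card_fin, (Finset.mem_powersetCard.1 hS).2,
      Nat.cast_sub hk.le]
  rw [Finset.sum_congr rfl h2, ← Finset.mul_sum] at h1
  have hk1 : (0 : ℝ) < (k : ℝ) + 1 := by positivity
  unfold levelMean
  rw [div_le_iff₀ hc']
  set a := ∑ S ∈ Finset.powersetCard (k + 1) (Finset.univ : Finset (Fin n)),
    phiMean φ μ (resample μ S *ᵥ f)
  set b := ∑ S ∈ Finset.powersetCard k (Finset.univ : Finset (Fin n)),
    phiMean φ μ (resample μ S *ᵥ f)
  refine le_of_mul_le_mul_left (h1.trans_eq ?_) hk1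
  calc ((n : ℝ) - k - 1 / C) * b
      = (1 - 1 / (C * (n - k : ℝ))) * (b / n.choose k) * (n.choose k * ((n : ℝ) - k)) := by
        rcases eq_or_ne C 0 with rfl | hC
        · field_simp
        · field_simp
    _ = _ := by rw [← hch]; ring

end Resample

/-! ### Numerical bounds on the rate. -/

section Rate

/-- Bernoulli with exponent `1/(C+1) ≤ 1` bounds the inverse of the right side by `1 + 1/((C+1)l)`,
whose product with `1 - 1/(Cl)` is at most `1`. -/
theorem one_sub_le_rpow {l C : ℝ} (hl : 0 < l) (hC : 0 < C) :
    1 - 1 / (C * l) ≤ (l / (l + 1)) ^ (1 / (C + 1)) := by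
  have h1 : (1 + 1 / l) ^ (1 / (C + 1)) ≤ 1 + 1 / (C + 1) * (1 / l) :=
    rpow_one_add_le_one_add_mul_self (by linarith [one_div_pos.2 hl]) (by positivity)
      ((div_le_one (by positivity)).2 (by linarith))
  have h2 : l / (l + 1) = (1 + 1 / l)⁻¹ := by field_simp
  rw [h2, Real.inv_rpow (by positivity)]
  have h3 : 0 < (1 + 1 / l) ^ (1 / (C + 1)) := by positivity
  refine le_trans ?_ (inv_anti₀ h3 h1)
  rw [← one_div, le_div_iff₀ (by positivity)]
  have : (1 - 1 / (C * l)) * (1 + 1 / (C + 1) * (1 / l)) =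
      1 - (1 / (C * (C + 1) * l) + 1 / (C * (C + 1) * l ^ 2)) := by
    field_simp
    ring
  rw [this]
  have : 0 ≤ 1 / (C * (C + 1) * l) + 1 / (C * (C + 1) * l ^ 2) := by positivity
  linarith

variable {n k : ℕ} {C : ℝ}

theorem one_sub_div_nonneg (hk : k ≤ n) : 0 ≤ 1 - (k : ℝ) / ((n : ℝ) + 1) := by
  have : (k : ℝ) ≤ n := by exact_mod_cast hk
  rw [sub_nonneg, div_le_one (by positivity)]
  linarith

theorem rate_nonneg (hk : k ≤ n) : 0 ≤ rate n k C := Real.rpow_nonneg (one_sub_div_nonneg hk) _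

theorem rate_zero : rate n 0 C = 1 := by simp [rate]

theorem mul_rate_le_rate_succ (hk : k < n) (hC : 0 < C) :
    (1 - 1 / (C * (n - k : ℝ))) * rate n k C ≤ rate n (k + 1) C := by
  have hnk : (0 : ℝ) < (n : ℝ) - k := sub_pos.2 (by exact_mod_cast hk)
  -- The telescoping factor is `l/(l+1)` with `l = n - k`.
  have h : 1 - ((k + 1 : ℕ) : ℝ) / ((n : ℝ) + 1) =
      ((n - k : ℝ) / ((n - k : ℝ) + 1)) * (1 - (k : ℝ) / ((n : ℝ) + 1)) := by
    have : (n : ℝ) - k + 1 ≠ 0 := by positivity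
    push_cast
    field_simp
    ring
  rw [rate, rate, h, Real.mul_rpow (by positivity) (one_sub_div_nonneg hk.le)]
  exact mul_le_mul_of_nonneg_right (one_sub_le_rpow hnk hC) (rate_nonneg hk.le)

theorem rate_le (hk1 : 1 ≤ k) (hk : k ≤ n) (hC : 0 < C) :
    rate n k C ≤ 1 - 1 / 2 * (k / ((C + 1) * n)) := by
  have hn : (1 : ℝ) ≤ n := by exact_mod_cast hk1.trans hk
  have h1 : (1 + -((k : ℝ) / ((n : ℝ) + 1))) ^ (1 / (C + 1)) ≤
      1 + 1 / (C + 1) * -((k : ℝ) / ((n : ℝ) + 1)) :=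
    rpow_one_add_le_one_add_mul_self (by linarith [one_sub_div_nonneg hk]) (by positivity)
      ((div_le_one (by positivity)).2 (by linarith))
  rw [← sub_eq_add_neg] at h1
  refine h1.trans ?_
  -- Replacing `n + 1` by `2n` costs the factor `1/2`.
  have h2 : (k : ℝ) / (2 * n) ≤ k / ((n : ℝ) + 1) :=
    div_le_div_of_nonneg_left (by positivity) (by positivity) (by linarith)
  have h3 : 1 / (C + 1) * ((k : ℝ) / (2 * n)) ≤ 1 / (C + 1) * (k / ((n : ℝ) + 1)) :=
    mul_le_mul_of_nonneg_left h2 (by positivity)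
  have h4 : 1 / (C + 1) * ((k : ℝ) / (2 * n)) = 1 / 2 * (k / ((C + 1) * n)) := by
    field_simp
  linarith

theorem rate_le_of_one_le (hk1 : 1 ≤ k) (hk : k ≤ n) (hC : 1 ≤ C) :
    rate n k C ≤ 1 - 1 / 4 * (k / (C * n)) := by
  have hn : (1 : ℝ) ≤ n := by exact_mod_cast hk1.trans hk
  have h1 : (k : ℝ) / (2 * (C * n)) ≤ k / ((C + 1) * n) :=
    div_le_div_of_nonneg_left (by positivity) (by positivity) (by nlinarith)
  have h2 : (k : ℝ) / (2 * (C * n)) = 1 / 2 * (k / (C * n)) := by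
    field_simp
  linarith [rate_le hk1 hk (by linarith : 0 < C)]

end Rate

/-! ### Decay of level means and contraction of divergences. -/

section Level

variable {n : ℕ} {Ω : Fin n → Type u} [∀ i, Fintype (Ω i)] [∀ i, DecidableEq (Ω i)]
  {μ : (∀ i, Ω i) → ℝ} {φ : ℝ → ℝ} {s : Set ℝ} {C : ℝ} {k : ℕ}

/-- A convex function on `s ⊇ [0, ∞)` that lies strictly above a tangent at its zero `1`. -/
structure IsGenerator (φ : ℝ → ℝ) (s : Set ℝ) : Prop where
  convex : ConvexOn ℝ s φ
  subset : Set.Ici 0 ⊆ s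
  map_one : φ 1 = 0
  tangent : ∃ a, ∀ t ∈ s, t ≠ 1 → a * (t - 1) < φ t

theorem IsGenerator.phiMean_nonneg {A : Type v} [Fintype A] {μ : A → ℝ} (hφ : IsGenerator φ s)
    (hμ : μ ∈ stdSimplex ℝ A) {f : A → ℝ} (hf : ∀ x, f x ∈ s)
    (hm : ∑ x, μ x * f x = 1) : 0 ≤ phiMean φ μ f := by
  obtain ⟨a, ha⟩ := hφ.tangent
  refine KGlauber.phiMean_nonneg (a := a) hμ (fun t ht => ?_) hf hm
  rcases eq_or_ne t 1 with rfl | h1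
  · simp [hφ.map_one]
  · exact (ha t ht h1).le

theorem IsGenerator.levelMean_nonneg (hφ : IsGenerator φ s) (hμ : μ ∈ stdSimplex ℝ (∀ i, Ω i))
    {f : (∀ i, Ω i) → ℝ} (hf : ∀ x, f x ∈ s) (hm : ∑ x, μ x * f x = 1) :
    0 ≤ levelMean φ μ k f :=
  div_nonneg (Finset.sum_nonneg fun S _ => hφ.phiMean_nonneg hμ
    ((resample_isReversible hμ.1 S).mulVec_mem hφ.convex.1 hf)
    (by rw [(resample_isReversible hμ.1 S).sum_mulVec, hm])) (Nat.cast_nonneg _)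

theorem Tensorizes.levelMean_le_rate (h : Tensorizes φ s μ C) (hφ : IsGenerator φ s)
    (hμ : μ ∈ stdSimplex ℝ (∀ i, Ω i)) (hC : 0 < C) (hk : k ≤ n)
    {f : (∀ i, Ω i) → ℝ} (hf : ∀ x, f x ∈ s) (hm : ∑ x, μ x * f x = 1) :
    levelMean φ μ k f ≤ rate n k C * phiMean φ μ f := by
  induction k with
  | zero => simp [levelMean_zero hμ.1, rate_zero]
  | succ k ih =>
    have h0 := hφ.phiMean_nonneg hμ hf hm
    have hL := hφ.levelMean_nonneg (k := k) hμ hf hm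
    have h1 := h.levelMean_succ_le hμ.1 hφ.convex hf hm hk
    -- A negative factor, possible when `C (n - k) < 1`, cannot multiply the induction hypothesis;
    -- but then the left side is nonpositive.
    rcases le_total (1 - 1 / (C * (n - k : ℝ))) 0 with hneg | hpos
    · exact (h1.trans (mul_nonpos_of_nonpos_of_nonneg hneg hL)).trans
        (mul_nonneg (rate_nonneg hk) h0)
    · calc _ ≤ _ := h1
        _ ≤ (1 - 1 / (C * (n - k : ℝ))) * (rate n k C * phiMean φ μ f) :=
          mul_le_mul_of_nonneg_left (ih (Nat.le_of_succ_le hk)) hpos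
        _ = (1 - 1 / (C * (n - k : ℝ))) * rate n k C * phiMean φ μ f := by ring
        _ ≤ _ := mul_le_mul_of_nonneg_right (mul_rate_le_rate_succ hk hC) h0

/-- Tensorization with a constant below `1` forces the support to be a single point. -/
theorem Tensorizes.eq_of_lt_one (h : Tensorizes φ s μ C) (hφ : IsGenerator φ s)
    (hμ : μ ∈ stdSimplex ℝ (∀ i, Ω i)) (hC : 0 < C) (hC1 : C < 1) {x y : ∀ i, Ω i}
    (hx : μ x ≠ 0) (hy : μ y ≠ 0) : x = y := by
  obtain ⟨a, ha⟩ := hφ.tangent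
  funext i
  -- The density of the point mass at `x`.
  set f : (∀ i, Ω i) → ℝ := Pi.single x (μ x)⁻¹
  have hf : ∀ z, f z ∈ s := fun z => hφ.subset <| by
    simp only [f, Pi.single_apply, Set.mem_Ici]
    split_ifs
    · exact inv_nonneg.2 (hμ.1 x)
    · exact le_rfl
  have hm : ∑ z, μ z * f z = 1 := by simp [f, Pi.single_apply, hx]
  -- With only coordinate `i` left, the left side is the `φ`-mean of the constant `1`, which is
  -- zero. As `1 - 1/C < 0`, the marginal density on coordinate `i` has nonpositive `φ`-mean, so it
  -- equals `1` at `y`; were `x i ≠ y i`, it would vanish there.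
  have h1 := h.sum_insert_le hμ.1 hφ.convex hf hm {i}ᶜ
  have hR := resample_isReversible hμ.1 ({i}ᶜ : Finset (Fin n))
  have hu : phiMean φ μ (resample μ Finset.univ *ᵥ f) = 0 := by
    rw [phiMean_congr fun z hz => (resample_univ_mulVec hμ f hz).trans hm]
    simp [phiMean, hφ.map_one]
  have hins : insert i ({i}ᶜ : Finset (Fin n)) = Finset.univ := by ext j; simp
  simp only [compl_compl, Finset.sum_singleton, Finset.card_singleton, Nat.cast_one] at h1
  rw [hins, hu] at h1
  have hneg : 1 - 1 / C < 0 := by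
    have := (one_lt_div hC).2 hC1
    linarith
  have hle : phiMean φ μ (resample μ {i}ᶜ *ᵥ f) ≤ 0 := by
    by_contra hcon
    exact absurd h1 (not_le.2 (mul_neg_of_neg_of_pos hneg (not_le.1 hcon)))
  have h2 := eq_one_of_phiMean_nonpos hμ ha hφ.map_one (hR.mulVec_mem hφ.convex.1 hf)
    (by rw [hR.sum_mulVec, hm]) hle hy
  by_contra hxy
  rw [resample_mulVec hμ.1 _ hy] at h2
  have h3 : ∀ z : ∀ i, Ω i, (if ∀ j, j ∉ ({i}ᶜ : Finset (Fin n)) → z j = y j then μ z * f z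
      else 0) = 0 := fun z => by
    by_cases hz : z = x
    · simp [hz, hxy]
    · simp [f, hz]
  simp only [h3, Finset.sum_const_zero, zero_div] at h2
  exact zero_ne_one h2

theorem Tensorizes.phiMean_eq_zero (h : Tensorizes φ s μ C) (hφ : IsGenerator φ s)
    (hμ : μ ∈ stdSimplex ℝ (∀ i, Ω i)) (hC : 0 < C) (hC1 : C < 1) {f : (∀ i, Ω i) → ℝ}
    (hm : ∑ x, μ x * f x = 1) : phiMean φ μ f = 0 := by
  have h1 : ∀ x, μ x ≠ 0 → f x = 1 := fun x hx => by
    rw [← hm]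
    have : ∀ y, μ y * f y = μ y * f x := fun y => by
      by_cases hy : μ y = 0
      · simp [hy]
      · rw [h.eq_of_lt_one hφ hμ hC hC1 hx hy]
    simp only [this, ← Finset.sum_mul, hμ.2, one_mul]
  rw [phiMean_congr h1]
  simp [phiMean, hφ.map_one]

theorem Tensorizes.levelMean_le (h : Tensorizes φ s μ C) (hφ : IsGenerator φ s)
    (hμ : μ ∈ stdSimplex ℝ (∀ i, Ω i)) (hC : 0 < C) (hk1 : 1 ≤ k) (hk : k ≤ n)
    {f : (∀ i, Ω i) → ℝ} (hf : ∀ x, f x ∈ s) (hm : ∑ x, μ x * f x = 1) :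
    levelMean φ μ k f ≤ (1 - 1 / 4 * (k / (C * n))) * phiMean φ μ f := by
  have h1 := h.levelMean_le_rate hφ hμ hC hk hf hm
  rcases lt_or_ge C 1 with hC1 | hC1
  · simpa [h.phiMean_eq_zero hφ hμ hC hC1 hm] using h1
  · exact h1.trans (mul_le_mul_of_nonneg_right (rate_le_of_one_le hk1 hk hC1)
      (hφ.phiMean_nonneg hμ hf hm))

theorem contracts_glauber (hμ : μ ∈ stdSimplex ℝ (∀ i, Ω i)) (hφ : IsGenerator φ s) (hk : k ≤ n)
    {ρ : ℝ} (h : ∀ f : (∀ i, Ω i) → ℝ, (∀ x, f x ∈ s) → ∑ x, μ x * f x = 1 →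
      levelMean φ μ k f ≤ ρ * phiMean φ μ f) : Contracts φ μ (glauber μ k) ρ := by
  intro ν hν hac
  have hP := glauber_isReversible hμ.1 hk
  set f : (∀ i, Ω i) → ℝ := fun x => ν x / μ x
  -- Absolute continuity handles the null points of `μ`, where the quotient is `0` by convention.
  have hνf : ν = fun x => μ x * f x := funext fun x => by
    by_cases hx : μ x = 0
    · simp [hx, hac x hx]
    · simp [f, mul_div_cancel₀ _ hx]
  have hf : ∀ x, f x ∈ s := fun x => hφ.subset (div_nonneg (hν.1 x) (hμ.1 x))
  have hm : ∑ x, μ x * f x = 1 := by rw [← hν.2, hνf]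
  have h1 : divergence φ (ν ᵥ* glauber μ k) (μ ᵥ* glauber μ k) =
      phiMean φ μ (glauber μ k *ᵥ f) := by
    rw [hP.stationary]
    refine phiMean_congr fun x hx => ?_
    rw [hνf, hP.vecMul_eq, mul_div_cancel_left₀ _ hx]
  rw [h1]
  exact (phiMean_glauber_mulVec_le hμ.1 hk hφ.convex hf).trans (h f hf hm)

theorem klFun_isGenerator : IsGenerator klFun (Set.Ici 0) where
  convex := Real.convexOn_mul_log
  subset := subset_rfl
  map_one := by simp [klFun]
  -- This is `log u < u - 1` at `u = 1/t`, multiplied by `t`; at `t = 0` it reads `-1 < 0`.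
  tangent := ⟨1, fun t ht h1 => by
    rcases (Set.mem_Ici.1 ht).eq_or_lt with rfl | h0
    · simp [klFun]
    · have := Real.log_lt_sub_one_of_pos (inv_pos.2 h0) (by simpa using h1)
      rw [Real.log_inv] at this
      have h2 := mul_lt_mul_of_pos_left this h0
      rw [mul_sub, mul_inv_cancel₀ h0.ne'] at h2
      simp only [klFun]
      linarith⟩

/-- The domain is all of `ℝ` because the Poincaré inequality and `λ₂` involve functions of either
sign. -/
theorem chiSqFun_isGenerator : IsGenerator chiSqFun Set.univ where
  convex := by
    have h : ConvexOn ℝ Set.univ fun t : ℝ => t ^ 2 := even_two.convexOn_pow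
    have h1 := h.translate_left (-1)
    have h2 : ((fun t : ℝ => t ^ 2) ∘ fun z => z + -1) = chiSqFun :=
      funext fun t => by simp [chiSqFun, sub_eq_add_neg]
    rwa [h2, Set.preimage_univ] at h1
  subset := Set.subset_univ _
  map_one := by simp [chiSqFun]
  tangent := ⟨0, fun t _ h1 => by
    have : 0 < (t - 1) ^ 2 := by have := sub_ne_zero.2 h1; positivity
    simpa [chiSqFun] using this⟩

end Level

/-! ### Poincaré inequalities as `χ²` statements. -/

section Poincare

variable {n : ℕ} {Ω : Fin n → Type u} [∀ i, Fintype (Ω i)] [∀ i, DecidableEq (Ω i)]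
  {μ : (∀ i, Ω i) → ℝ} {C : ℝ} {k : ℕ}

theorem variance_add_const {A : Type v} [Fintype A] {μ : A → ℝ} (hμ : μ ∈ stdSimplex ℝ A)
    (f : A → ℝ) (a : ℝ) : variance μ (fun x => f x + a) = variance μ f := by
  simp only [variance, mul_add, Finset.sum_add_distrib, ← Finset.sum_mul, hμ.2]
  exact Finset.sum_congr rfl fun x _ => by ring

theorem dirichletForm_add_const {A : Type v} [Fintype A] {μ : A → ℝ} {P : Matrix A A ℝ}
    (hP : IsReversible μ P) (f : A → ℝ) (a : ℝ) :
    dirichletForm μ P (fun x => f x + a) (fun x => f x + a) = dirichletForm μ P f f := by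
  have h : ∀ x, (P *ᵥ fun x => f x + a) x = (P *ᵥ f) x + a := fun x => by
    have : (fun x => f x + a) = f + fun _ => a := rfl
    rw [this, Matrix.mulVec_add, Pi.add_apply, hP.mulVec_one]
  have h0 : ∑ x, μ x * (a * (f x - (P *ᵥ f) x)) = 0 := by
    have : ∀ x, μ x * (a * (f x - (P *ᵥ f) x)) = a * (μ x * f x) - a * (μ x * (P *ᵥ f) x) :=
      fun x => by ring
    simp only [this, Finset.sum_sub_distrib, ← Finset.mul_sum, hP.sum_mulVec, sub_self]
  rw [← add_zero (dirichletForm μ P f f), ← h0, dirichletForm, dirichletForm,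
    ← Finset.sum_add_distrib]
  refine Finset.sum_congr rfl fun x _ => ?_
  rw [h]
  ring

theorem phiMean_chiSqFun {A : Type v} [Fintype A] {μ : A → ℝ} (hμ : μ ∈ stdSimplex ℝ A)
    {f : A → ℝ} (hm : ∑ x, μ x * f x = 1) :
    phiMean chiSqFun μ f = ∑ x, μ x * f x ^ 2 - 1 := by
  have : ∀ x, μ x * (f x - 1) ^ 2 = μ x * f x ^ 2 - 2 * (μ x * f x) + μ x := fun x => by ring
  simp only [phiMean, chiSqFun, this, Finset.sum_add_distrib, Finset.sum_sub_distrib,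
    ← Finset.mul_sum, hm, hμ.2]
  ring

theorem variance_eq_phiMean {A : Type v} [Fintype A] {μ f : A → ℝ}
    (hm : ∑ x, μ x * f x = 1) : variance μ f = phiMean chiSqFun μ f := by
  simp [variance, phiMean, chiSqFun, hm]

/-- The dictionary used in both directions: `k = 1` turns the Poincaré hypothesis into
tensorization, and general `k` turns decay of level means back into a spectral bound. -/
theorem dirichletForm_glauber (hμ : μ ∈ stdSimplex ℝ (∀ i, Ω i)) (hk : k ≤ n)
    {f : (∀ i, Ω i) → ℝ} (hm : ∑ x, μ x * f x = 1) :
    dirichletForm μ (glauber μ k) f f = phiMean chiSqFun μ f - levelMean chiSqFun μ k f := by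
  have hc : (0 : ℝ) < n.choose k := by exact_mod_cast Nat.choose_pos hk
  have h1 : ∀ S, phiMean chiSqFun μ (resample μ S *ᵥ f) =
      ∑ x, μ x * (f x * (resample μ S *ᵥ f) x) - 1 := fun S => by
    rw [phiMean_chiSqFun hμ (by rw [(resample_isReversible hμ.1 S).sum_mulVec, hm]),
      sum_mul_mul_resample_mulVec hμ.1]
  have h2 : levelMean chiSqFun μ k f = ∑ x, μ x * (f x * (glauber μ k *ᵥ f) x) - 1 := by
    simp only [levelMean, h1, Finset.sum_sub_distrib, glauber_mulVec]
    rw [Finset.sum_comm, sub_div]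
    congr 1
    · rw [Finset.sum_div]
      refine Finset.sum_congr rfl fun x _ => ?_
      rw [← Finset.mul_sum, ← Finset.mul_sum]
      ring
    · simp [hc.ne']
  rw [h2, phiMean_chiSqFun hμ hm, dirichletForm]
  simp only [mul_sub, Finset.sum_sub_distrib, pow_two]
  ring

theorem Poincare.tensorizes (h : Poincare μ (glauber μ 1) (C * n))
    (hμ : μ ∈ stdSimplex ℝ (∀ i, Ω i)) (hC : 0 < C) (hn : 1 ≤ n) :
    Tensorizes chiSqFun Set.univ μ C := by
  intro f _ hm
  have h1 := h f
  have hn' : (0 : ℝ) < n := by exact_mod_cast hn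
  rw [variance_eq_phiMean hm, dirichletForm_glauber hμ hn hm] at h1
  simp only [levelMean, Finset.powersetCard_one, Finset.sum_map, Function.Embedding.coeFn_mk,
    Nat.choose_one_right] at h1
  set V := phiMean chiSqFun μ f
  set X := ∑ i, phiMean chiSqFun μ (resample μ {i} *ᵥ f)
  have h2 : C * n * (V - X / n) = C * (n * V - X) := by field_simp
  rw [h2] at h1
  have h3 : V / C ≤ n * V - X := by rw [div_le_iff₀ hC]; linarith
  have h4 : (n - 1 / C) * V = n * V - V / C := by ring
  linarith

/-- Variance and Dirichlet form ignore additive constants, so any function can be normalised to mean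
`1`. -/
theorem exists_shift {A : Type v} [Fintype A] {μ : A → ℝ} (hμ : μ ∈ stdSimplex ℝ A)
    (f : A → ℝ) : ∃ a : ℝ, ∑ x, μ x * (f x + a) = 1 :=
  ⟨1 - ∑ x, μ x * f x, by
    simp only [mul_add, Finset.sum_add_distrib, ← Finset.sum_mul, hμ.2]; ring⟩

theorem Tensorizes.poincare_glauber (h : Tensorizes chiSqFun Set.univ μ C)
    (hμ : μ ∈ stdSimplex ℝ (∀ i, Ω i)) (hC : 0 < C) (hk1 : 1 ≤ k) (hk : k ≤ n) :
    Poincare μ (glauber μ k) (4 * (C * n / k)) := by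
  intro f
  obtain ⟨a, ha⟩ := exists_shift hμ f
  have h1 := h.levelMean_le chiSqFun_isGenerator hμ hC hk1 hk (fun x => Set.mem_univ _) ha
  rw [← variance_add_const hμ f a, ← dirichletForm_add_const (glauber_isReversible hμ.1 hk) f a,
    variance_eq_phiMean ha, dirichletForm_glauber hμ hk ha]
  have hk0 : (0 : ℝ) < k := by exact_mod_cast hk1
  have hn0 : (0 : ℝ) < n := by exact_mod_cast hk1.trans hk
  set V := phiMean chiSqFun μ fun x => f x + a
  have h2 : 1 / 4 * (k / (C * n)) * V ≤ V - levelMean chiSqFun μ k fun x => f x + a := by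
    linarith
  calc V = 4 * (C * n / k) * (1 / 4 * (k / (C * n)) * V) := by field_simp
    _ ≤ _ := mul_le_mul_of_nonneg_left h2 (by positivity)

theorem Tensorizes.sum_mul_glauber_le (h : Tensorizes chiSqFun Set.univ μ C)
    (hμ : μ ∈ stdSimplex ℝ (∀ i, Ω i)) (hC : 0 < C) (hk : k ≤ n)
    {f : (∀ i, Ω i) → ℝ} (hm : ∑ x, μ x * f x = 0) :
    ∑ x, μ x * (f x * (glauber μ k *ᵥ f) x) ≤ rate n k C * ∑ x, μ x * f x ^ 2 := by
  have ha : ∑ x, μ x * (f x + 1) = 1 := by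
    simp [mul_add, Finset.sum_add_distrib, hm, hμ.2]
  have h1 := h.levelMean_le_rate chiSqFun_isGenerator hμ hC hk (fun x => Set.mem_univ _) ha
  have h2 := dirichletForm_glauber hμ hk ha
  rw [dirichletForm_add_const (glauber_isReversible hμ.1 hk) f 1] at h2
  have h3 : phiMean chiSqFun μ (fun x => f x + 1) = ∑ x, μ x * f x ^ 2 := by
    simp [phiMean, chiSqFun]
  have h4 : dirichletForm μ (glauber μ k) f f =
      ∑ x, μ x * f x ^ 2 - ∑ x, μ x * (f x * (glauber μ k *ᵥ f) x) := by
    rw [dirichletForm, ← Finset.sum_sub_distrib]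
    exact Finset.sum_congr rfl fun x _ => by ring
  rw [h3] at h1 h2
  linarith

end Poincare

/-! ### Min-max for the second eigenvalue. -/

section SecondEigenvalue

variable {A : Type u} [Fintype A]

theorem exists_ne_zero_mul_add_mul_eq_zero (a b : ℝ) :
    ∃ s t : ℝ, 0 < s ^ 2 + t ^ 2 ∧ s * a + t * b = 0 := by
  by_cases h : a = 0
  · exact ⟨1, 0, by norm_num, by simp [h]⟩
  · exact ⟨b, -a, by rw [neg_sq]; positivity, by ring⟩

/-- A form of the min-max principle: if the quadratic form of a symmetric matrix is at most
`r ‖v‖²` on a hyperplane, then its second largest eigenvalue is at most `r`. -/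
theorem eigenvaluesDesc_getD_one_le [DecidableEq A] {H : Matrix A A ℝ} (hH : H.IsHermitian)
    {r : ℝ} (hr : 0 ≤ r) (w : A → ℝ)
    (h : ∀ v : A → ℝ, v ⬝ᵥ w = 0 → v ⬝ᵥ (H *ᵥ v) ≤ r * (v ⬝ᵥ v)) :
    (eigenvaluesDesc H).getD 1 0 ≤ r := by
  have hlist : eigenvaluesDesc H = List.ofFn hH.eigenvalues₀ := by
    have := hH.sort_roots_charpoly_eq_eigenvalues₀
    simpa [eigenvaluesDesc] using this
  rw [hlist]
  by_cases hcard : 1 < Fintype.card A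
  swap
  -- With at most one eigenvalue the default value `0` is returned, which is where `0 ≤ r` enters.
  · rw [List.getD_eq_default _ _ (by simpa using hcard)]
    exact hr
  rw [List.getD_eq_getElem _ _ (by simpa using hcard), List.getElem_ofFn]
  let e : Fin (Fintype.card A) ≃ A := Fintype.equivOfCardEq (Fintype.card_fin _)
  let i₀ : A := e ⟨0, by omega⟩
  let i₁ : A := e ⟨1, hcard⟩
  have hne : i₀ ≠ i₁ := fun hi => by simpa using e.injective hi
  have h₁ : hH.eigenvalues₀ ⟨1, hcard⟩ = hH.eigenvalues i₁ := by
    simp [Matrix.IsHermitian.eigenvalues, i₁, e]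
  have h₀ : hH.eigenvalues i₁ ≤ hH.eigenvalues i₀ := by
    have : hH.eigenvalues i₀ = hH.eigenvalues₀ ⟨0, by omega⟩ := by
      simp [Matrix.IsHermitian.eigenvalues, i₀, e]
    rw [← h₁, this]
    exact hH.eigenvalues₀_antitone (by simp [Fin.le_def])
  rw [h₁]
  set p : A → ℝ := ⇑(hH.eigenvectorBasis i₀)
  set q : A → ℝ := ⇑(hH.eigenvectorBasis i₁)
  have hp : H *ᵥ p = hH.eigenvalues i₀ • p := hH.mulVec_eigenvectorBasis i₀
  have hq : H *ᵥ q = hH.eigenvalues i₁ • q := hH.mulVec_eigenvectorBasis i₁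
  have hort : ∀ i j, (⇑(hH.eigenvectorBasis i) : A → ℝ) ⬝ᵥ ⇑(hH.eigenvectorBasis j) =
      if j = i then 1 else 0 := fun i j => by
    have := orthonormal_iff_ite.1 hH.eigenvectorBasis.orthonormal j i
    rw [EuclideanSpace.inner_eq_star_dotProduct] at this
    simpa using this
  have hpp : p ⬝ᵥ p = 1 := by simpa using hort i₀ i₀
  have hqq : q ⬝ᵥ q = 1 := by simpa using hort i₁ i₁
  have hpq : p ⬝ᵥ q = 0 := by simpa [hne.symm] using hort i₀ i₁
  have hqp : q ⬝ᵥ p = 0 := by rw [dotProduct_comm, hpq]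
  -- The span of the top two eigenvectors meets the hyperplane `w^⊥` in a nonzero vector, whose
  -- Rayleigh quotient is at least the second eigenvalue.
  obtain ⟨s, t, hst, h0⟩ := exists_ne_zero_mul_add_mul_eq_zero (p ⬝ᵥ w) (q ⬝ᵥ w)
  have hv := h (s • p + t • q) (by simpa [add_dotProduct, smul_dotProduct] using h0)
  simp only [Matrix.mulVec_add, Matrix.mulVec_smul, hp, hq, add_dotProduct, dotProduct_add,
    smul_dotProduct, dotProduct_smul, hpp, hqq, hpq, hqp, smul_eq_mul] at hv
  have hmul : hH.eigenvalues i₁ * s ^ 2 ≤ hH.eigenvalues i₀ * s ^ 2 :=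
    mul_le_mul_of_nonneg_right h₀ (sq_nonneg s)
  refine le_of_mul_le_mul_right ?_ hst
  linarith

theorem lambda2_le [DecidableEq A] {μ : A → ℝ} {P : Matrix A A ℝ} (hP : IsReversible μ P)
    (hμ : ∀ x, 0 ≤ μ x) {r : ℝ} (hr : 0 ≤ r)
    (h : ∀ f : A → ℝ, ∑ x, μ x * f x = 0 →
      ∑ x, μ x * (f x * (P *ᵥ f) x) ≤ r * ∑ x, μ x * f x ^ 2) :
    lambda2 μ P ≤ r := by
  -- Conjugation by `diag(√μ)` symmetrises the chain, keeps its characteristic polynomial, and turns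
  -- mean zero into orthogonality to `w`.
  let w : {x // 0 < μ x} → ℝ := fun x => √(μ x)
  have hw : ∀ x, 0 < w x := fun x => Real.sqrt_pos.2 x.2
  have hw2 : ∀ x, μ x.1 = w x * w x := fun x => (Real.mul_self_sqrt (hμ x.1)).symm
  let W : (Matrix {x // 0 < μ x} {x // 0 < μ x} ℝ)ˣ :=
    { val := Matrix.diagonal w
      inv := Matrix.diagonal fun x => (w x)⁻¹
      val_inv := by
        rw [Matrix.diagonal_mul_diagonal, ← Matrix.diagonal_one]
        congr 1; funext x; exact mul_inv_cancel₀ (hw x).ne'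
      inv_val := by
        rw [Matrix.diagonal_mul_diagonal, ← Matrix.diagonal_one]
        congr 1; funext x; exact inv_mul_cancel₀ (hw x).ne' }
  let H : Matrix {x // 0 < μ x} {x // 0 < μ x} ℝ := W.val * onSupport μ P * (W⁻¹).val
  have hH_apply : ∀ x y, H x y = w x * P x.1 y.1 * (w y)⁻¹ := fun x y => by
    change (Matrix.diagonal w * onSupport μ P * Matrix.diagonal fun x => (w x)⁻¹) x y = _
    rw [Matrix.mul_diagonal, Matrix.diagonal_mul]
    rfl
  have hchar : H.charpoly = (onSupport μ P).charpoly := by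
    simp only [H, Matrix.coe_units_inv, Matrix.charpoly_units_conj]
  have hH : H.IsHermitian := by
    refine Matrix.IsHermitian.ext fun x y => ?_
    rw [star_trivial, hH_apply, hH_apply]
    have hb := hP.balance x.1 y.1
    rw [hw2 x, hw2 y] at hb
    have hx := (hw x).ne'
    have hy := (hw y).ne'
    field_simp
    linarith
  have hlam : lambda2 μ P = (eigenvaluesDesc H).getD 1 0 := by
    rw [lambda2, eigenvaluesDesc, eigenvaluesDesc, hchar]
  rw [hlam]
  refine eigenvaluesDesc_getD_one_le hH hr w fun v hv => ?_
  -- Extension by zero makes `P *ᵥ f` on the support agree with the restricted matrix.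
  let f : A → ℝ := fun x => if hx : 0 < μ x then v ⟨x, hx⟩ / w ⟨x, hx⟩ else 0
  have hf : ∀ x : {x // 0 < μ x}, f x.1 = v x / w x := fun x => dif_pos x.2
  have hsum : ∀ (G : A → ℝ) (F : {x // 0 < μ x} → ℝ), (∀ x, ¬ 0 < μ x → G x = 0) →
      (∀ x, F x = G x.1) → ∑ x, G x = ∑ x, F x := fun G F hG hF =>
    (Fintype.sum_of_injective Subtype.val Subtype.val_injective F G
      (fun x hx => hG x fun h' => hx ⟨⟨x, h'⟩, rfl⟩) hF).symm
  have hz : ∀ x, ¬ 0 < μ x → μ x = 0 := fun x hx => le_antisymm (not_lt.1 hx) (hμ x)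
  have h1 : ∑ x, μ x * f x = v ⬝ᵥ w := hsum _ _ (fun x hx => by simp [hz x hx]) fun x => by
    have hx := (hw x).ne'
    rw [hf, hw2]
    field_simp
  have h2 : ∑ x, μ x * f x ^ 2 = v ⬝ᵥ v := hsum _ _ (fun x hx => by simp [hz x hx]) fun x => by
    have hx := (hw x).ne'
    rw [hf, hw2]
    field_simp
  have h3 : ∑ x, μ x * (f x * (P *ᵥ f) x) = v ⬝ᵥ (H *ᵥ v) :=
    hsum _ _ (fun x hx => by simp [hz x hx]) fun x => by
      have hx := (hw x).ne'
      have : (P *ᵥ f) x.1 = ∑ y : {x // 0 < μ x}, P x.1 y.1 * (v y / w y) :=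
        hsum _ _ (fun y hy => by simp [f, hy]) fun y => by rw [hf]
      have h4 : (H *ᵥ v) x = w x * (P *ᵥ f) x.1 := by
        rw [this, Matrix.mulVec, dotProduct, Finset.mul_sum]
        exact Finset.sum_congr rfl fun y _ => by rw [hH_apply]; ring
      rw [h4, hf, hw2]
      field_simp
  rw [← h2, ← h3]
  exact h f (h1.trans hv)

end SecondEigenvalue

/-! ### From the down operator to single-site resampling. -/

section Homogenization

variable {n : ℕ} {Ω : Fin n → Type u} [∀ i, DecidableEq (Ω i)]

theorem mem_graphSet {σ : ∀ i, Ω i} {a : Σ i, Ω i} : a ∈ graphSet σ ↔ σ a.1 = a.2 := by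
  obtain ⟨i, b⟩ := a
  simp only [graphSet, Finset.mem_image, Finset.mem_univ, true_and]
  constructor
  · rintro ⟨j, hj⟩
    cases hj
    rfl
  · rintro rfl
    exact ⟨i, rfl⟩

theorem graphSet_card (σ : ∀ i, Ω i) : (graphSet σ).card = n := by
  rw [graphSet, Finset.card_image_of_injective _ fun i j h => congrArg Sigma.fst h]
  simp

theorem graphSet_injective : Function.Injective (graphSet (Ω := Ω)) := by
  intro σ τ h
  funext i
  have : (⟨i, τ i⟩ : Σ i, Ω i) ∈ graphSet σ := by rw [h, mem_graphSet]
  exact mem_graphSet.1 this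

/-- `graphSet` as a map to the `n`-element sets. -/
def toSlice (σ : ∀ i, Ω i) : Slice (Σ i, Ω i) n := ⟨graphSet σ, graphSet_card σ⟩

/-- The graph of `σ` with the element over `i` removed. -/
def eraseSlice (σ : ∀ i, Ω i) (i : Fin n) : Slice (Σ i, Ω i) (n - 1) :=
  ⟨(graphSet σ).erase ⟨i, σ i⟩, by
    rw [Finset.card_erase_of_mem (mem_graphSet.2 rfl), graphSet_card]⟩

theorem eraseSlice_subset_graphSet {σ τ : ∀ i, Ω i} {i : Fin n} :
    (eraseSlice σ i).1 ⊆ graphSet τ ↔ ∀ j, j ∉ ({i} : Finset (Fin n)) → τ j = σ j := by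
  constructor
  · intro h j hj
    refine (mem_graphSet (a := ⟨j, σ j⟩)).1
      (h (Finset.mem_erase.2 ⟨?_, mem_graphSet.2 rfl⟩))
    intro h'
    exact hj (Finset.mem_singleton.2 (congrArg Sigma.fst h'))
  · rintro h ⟨j, b⟩ hjb
    obtain ⟨hne, hmem⟩ := Finset.mem_erase.1 hjb
    have hb : σ j = b := mem_graphSet.1 hmem
    subst hb
    refine mem_graphSet.2 (h j fun hj => hne ?_)
    rw [Finset.mem_singleton.1 hj]

variable [∀ i, Fintype (Ω i)]

theorem sum_homogenization_mul (ν : (∀ i, Ω i) → ℝ) (G : Slice (Σ i, Ω i) n → ℝ) :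
    ∑ A, homogenization ν A * G A = ∑ σ, ν σ * G (toSlice σ) := by
  simp only [homogenization, Finset.sum_mul]
  rw [Finset.sum_comm]
  refine Finset.sum_congr rfl fun σ _ => ?_
  rw [Finset.sum_eq_single (toSlice σ)]
  · simp [toSlice]
  · intro B _ hB
    rw [if_neg fun h => hB (Subtype.ext h.symm), zero_mul]
  · simp

theorem homogenization_toSlice (ν : (∀ i, Ω i) → ℝ) (σ : ∀ i, Ω i) :
    homogenization ν (toSlice σ) = ν σ := by
  simp [homogenization, toSlice, graphSet_injective.eq_iff]

theorem homogenization_mem_stdSimplex {ν : (∀ i, Ω i) → ℝ} (hν : ν ∈ stdSimplex ℝ (∀ i, Ω i)) :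
    homogenization ν ∈ stdSimplex ℝ (Slice (Σ i, Ω i) n) := by
  refine ⟨fun A => Finset.sum_nonneg fun σ _ => ?_, ?_⟩
  · split_ifs
    · exact hν.1 σ
    · exact le_rfl
  · simpa [hν.2] using sum_homogenization_mul ν fun _ => 1

theorem homogenization_eq_zero {μ ν : (∀ i, Ω i) → ℝ} (hμ : ∀ σ, 0 ≤ μ σ)
    (h : ∀ σ, μ σ = 0 → ν σ = 0) {A : Slice (Σ i, Ω i) n} (hA : homogenization μ A = 0) :
    homogenization ν A = 0 := by
  have h0 := (Finset.sum_eq_zero_iff_of_nonneg fun σ _ => by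
    split_ifs
    · exact hμ σ
    · exact le_rfl).1 hA
  refine Finset.sum_eq_zero fun σ hσ => ?_
  have := h0 σ hσ
  split_ifs at this ⊢
  · exact h σ this
  · rfl

theorem divergence_homogenization (φ : ℝ → ℝ) (ν μ : (∀ i, Ω i) → ℝ) :
    divergence φ (homogenization ν) (homogenization μ) = divergence φ ν μ := by
  rw [divergence, sum_homogenization_mul μ fun A => φ (homogenization ν A / homogenization μ A)]
  simp [divergence, homogenization_toSlice]

/-- The `(n - 1)`-subsets of a graph correspond to the coordinate erased. -/
theorem sum_subset_graphSet (hn : 1 ≤ n) (σ : ∀ i, Ω i) (G : Slice (Σ i, Ω i) (n - 1) → ℝ) :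
    ∑ B, (if B.1 ⊆ graphSet σ then G B else 0) = ∑ i, G (eraseSlice σ i) := by
  rw [← Finset.sum_filter]
  symm
  refine Finset.sum_bij (fun i _ => eraseSlice σ i) ?_ ?_ ?_ fun _ _ => rfl
  · intro i _
    exact Finset.mem_filter.2 ⟨Finset.mem_univ _, Finset.erase_subset _ _⟩
  · intro i _ j _ hij
    by_contra hne
    have h1 : (⟨i, σ i⟩ : Σ i, Ω i) ∈ (eraseSlice σ j).1 :=
      Finset.mem_erase.2 ⟨fun h => hne (congrArg Sigma.fst h), mem_graphSet.2 rfl⟩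
    rw [← hij] at h1
    exact (Finset.mem_erase.1 h1).1 rfl
  · intro B hB
    have hsub : B.1 ⊆ graphSet σ := (Finset.mem_filter.1 hB).2
    obtain ⟨a, ha, hins⟩ := Finset.exists_eq_insert_iff.2
      ⟨hsub, by rw [B.2, graphSet_card]; omega⟩
    obtain ⟨i, b⟩ := a
    have hb : σ i = b := mem_graphSet.1 (hins ▸ Finset.mem_insert_self _ _)
    subst hb
    refine ⟨i, Finset.mem_univ i, Subtype.ext ?_⟩
    simp only [eraseSlice]
    rw [← hins, Finset.erase_insert ha]

theorem homogenization_vecMul_down (hn : 1 ≤ n) (ν : (∀ i, Ω i) → ℝ)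
    (B : Slice (Σ i, Ω i) (n - 1)) :
    (homogenization ν ᵥ* down (Σ i, Ω i) n (n - 1)) B =
      (∑ σ, if B.1 ⊆ graphSet σ then ν σ else 0) / n := by
  have hch : n.choose (n - 1) = n := by
    obtain ⟨m, rfl⟩ := Nat.exists_eq_add_of_le' hn
    simp
  rw [Matrix.vecMul, dotProduct, sum_homogenization_mul ν fun A => down (Σ i, Ω i) n (n - 1) A B,
    Finset.sum_div]
  refine Finset.sum_congr rfl fun σ _ => ?_
  simp only [down, toSlice, Matrix.of_apply, hch]
  split_ifs <;> simp [div_eq_mul_inv]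

/-- A graph with its `i`-th point removed records exactly the coordinates off `i`, so the density of
the image there is `f` averaged by `resample μ {i}`. -/
theorem divergence_homogenization_down (hn : 1 ≤ n) (φ : ℝ → ℝ) {μ : (∀ i, Ω i) → ℝ}
    (hμ : ∀ σ, 0 ≤ μ σ) (f : (∀ i, Ω i) → ℝ) :
    divergence φ (homogenization (fun σ => μ σ * f σ) ᵥ* down (Σ i, Ω i) n (n - 1))
        (homogenization μ ᵥ* down (Σ i, Ω i) n (n - 1)) =
      (∑ i, phiMean φ μ (resample μ {i} *ᵥ f)) / n := by
  have hn0 : (n : ℝ) ≠ 0 := by exact_mod_cast (Nat.one_le_iff_ne_zero.1 hn)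
  set q : Slice (Σ i, Ω i) (n - 1) → ℝ := fun B =>
    (homogenization (fun σ => μ σ * f σ) ᵥ* down (Σ i, Ω i) n (n - 1)) B /
      (homogenization μ ᵥ* down (Σ i, Ω i) n (n - 1)) B with hq
  have hq' : ∀ σ i, μ σ ≠ 0 → q (eraseSlice σ i) = (resample μ {i} *ᵥ f) σ := by
    intro σ i hσ
    simp only [hq, homogenization_vecMul_down hn]
    rw [resample_mulVec hμ {i} hσ, div_div_div_cancel_right₀ hn0, marginalOff]
    simp only [eraseSlice_subset_graphSet]
  calc _ = ∑ B, (∑ σ, if B.1 ⊆ graphSet σ then μ σ else 0) / n * φ (q B) :=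
        Finset.sum_congr rfl fun B _ => by rw [← homogenization_vecMul_down hn]
    _ = (∑ σ, μ σ * ∑ B, if B.1 ⊆ graphSet σ then φ (q B) else 0) / n := by
        simp only [Finset.mul_sum, Finset.sum_div, Finset.sum_mul]
        rw [Finset.sum_comm]
        refine Finset.sum_congr rfl fun σ _ => Finset.sum_congr rfl fun B _ => ?_
        split_ifs
        · ring
        · simp
    _ = (∑ i, phiMean φ μ fun σ => q (eraseSlice σ i)) / n := by
        simp only [sum_subset_graphSet hn, Finset.mul_sum]
        rw [Finset.sum_comm]
        rfl
    _ = _ := by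
        congr 1
        exact Finset.sum_congr rfl fun i _ => phiMean_congr fun σ hσ => hq' σ i hσ

theorem ApproxTensorization.tensorizes {μ : (∀ i, Ω i) → ℝ} {C : ℝ}
    (h : ApproxTensorization μ C) (hμ : μ ∈ stdSimplex ℝ (∀ i, Ω i)) (hn : 1 ≤ n) :
    Tensorizes klFun (Set.Ici 0) μ C := by
  intro f hf hm
  have hn0 : (0 : ℝ) < n := by exact_mod_cast hn
  have h1 := h (homogenization fun σ => μ σ * f σ)
    (homogenization_mem_stdSimplex ⟨fun σ => mul_nonneg (hμ.1 σ) (hf σ), hm⟩)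
    (fun A hA => homogenization_eq_zero hμ.1 (fun σ hσ => by simp [hσ]) hA)
  rw [divergence_homogenization_down hn _ hμ.1, divergence_homogenization, div_le_iff₀ hn0] at h1
  have h2 : divergence klFun (fun σ => μ σ * f σ) μ = phiMean klFun μ f :=
    phiMean_congr fun σ hσ => mul_div_cancel_left₀ _ hσ
  rw [h2] at h1
  refine h1.trans_eq ?_
  rcases eq_or_ne C 0 with rfl | hC
  · simp [mul_comm]
  · field_simp

end Homogenization

end KGlauber

end

theorem theoremt :
    ∃ c > (0 : ℝ), ∃ K > (0 : ℝ),
      ∀ (n k : ℕ) (_ : 1 ≤ k) (_ : k ≤ n) (C : ℝ) (_ : 0 < C),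
        KGlauber.rate n k C ≤ 1 - c * (k / ((C + 1) * n)) ∧
        ∀ (Ω : Fin n → Type*) [∀ i, Fintype (Ω i)] [∀ i, DecidableEq (Ω i)]
          (μ : (∀ i, Ω i) → ℝ) (_ : μ ∈ stdSimplex ℝ (∀ i, Ω i)),
          (KGlauber.Poincare μ (KGlauber.glauber μ 1) (C * n) →
            (1 < Fintype.card {x // 0 < μ x} →
              KGlauber.lambda2 μ (KGlauber.glauber μ k) ≤ KGlauber.rate n k C) ∧
            KGlauber.Poincare μ (KGlauber.glauber μ k) (K * (C * n / k)) ∧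
            KGlauber.Contracts KGlauber.chiSqFun μ (KGlauber.glauber μ k)
              (1 - c * (k / (C * n)))) ∧
          (KGlauber.ApproxTensorization μ C →
            KGlauber.Contracts KGlauber.klFun μ (KGlauber.glauber μ k) (KGlauber.rate n k C) ∧
            KGlauber.Contracts KGlauber.klFun μ (KGlauber.glauber μ k)
              (1 - c * (k / (C * n)))) := by
  -- `1/4` combines the losses in `n + 1 ≤ 2n` and, for `C ≥ 1`, `C + 1 ≤ 2C`; `K` is its inverse.
  refine ⟨1 / 4, by norm_num, 4, by norm_num, fun n k hk1 hk C hC => ⟨?_, ?_⟩⟩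
  · have : 0 ≤ (k : ℝ) / ((C + 1) * n) := by positivity
    linarith [KGlauber.rate_le hk1 hk hC]
  intro Ω _ _ μ hμ
  have hn : 1 ≤ n := hk1.trans hk
  refine ⟨fun h => ?_, fun h => ?_⟩
  · have ht := h.tensorizes hμ hC hn
    exact ⟨fun _ => KGlauber.lambda2_le (KGlauber.glauber_isReversible hμ.1 hk) hμ.1
        (KGlauber.rate_nonneg hk) fun f hm => ht.sum_mul_glauber_le hμ hC hk hm,
      ht.poincare_glauber hμ hC hk1 hk,
      KGlauber.contracts_glauber hμ KGlauber.chiSqFun_isGenerator hk fun f hf hm =>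
        ht.levelMean_le KGlauber.chiSqFun_isGenerator hμ hC hk1 hk hf hm⟩
  · have ht := h.tensorizes hμ hn
    exact ⟨KGlauber.contracts_glauber hμ KGlauber.klFun_isGenerator hk fun f hf hm =>
        ht.levelMean_le_rate KGlauber.klFun_isGenerator hμ hC hk hf hm,
      KGlauber.contracts_glauber hμ KGlauber.klFun_isGenerator hk fun f hf hm =>
        ht.levelMean_le KGlauber.klFun_isGenerator hμ hC hk1 hk hf hm⟩
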